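/- Theorem. Let $\lambda$ be Lebesgue measure on $[0,1]$, regarded as a measure on $\mathbb R$. For a finite Borel measure $\nu$ on $\mathbb R$ and $t>0$, let $C_t\nu$ be the contraction of $\nu$ by $t$, that is, $C_t\nu(A)=\int \mathbf 1_A(ts)\,d\nu(s)$ for Borel sets $A\subset\mathbb R$, and write $\nu * f(x)=\int f(x-y)\,d\nu(y)$. Then there exist positive integers $n_1<n_2<\cdots$ with $n_{m+1}/n_m\ge 4$ for all $m$, and a decreasing sequence of positive numbers $(t_k)$ with $\lim_k t_k=0$, such that the following holds for the Riesz product measure $$\mu=\prod_{m=1}^\infty\bigl(1+\cos(2\pi n_m x)\bigr),$$ i.e. the probability measure on $[0,1]$, regarded as a measure on $\mathbb R$, that is the weak* limit as $k\to\infty$ of the measures $\prod_{m=1}^k(1+\cos(2\pi n_m x))\,d\lambda(x)$. For $f\in L^2(\mathbb R)$ the convolutions $C_{t_k}\lambda * f$ and $C_{t_k}\mu * f$ are defined by absolutely convergent integrals almost everywhere, and the square function $$Sf=\Bigl(\sum_{k}\bigl|C_{t_k}\lambda * f-C_{t_k}\mu * f\bigr|^2\Bigr)^{1/2}$$ is measurable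 and has a strong $L^2$ bound: there is a constant $C<\infty$ such that $$\|Sf\|_{L^2(\mathbb R)}\le C\,\|f\|_{L^2(\mathbb R)}\qquad\text{for all } f\in L^2(\mathbb R).$$ -/

import Mathlib

open MeasureTheory Filter Topology
open scoped ENNReal NNReal

noncomputable section

/-- The partial product `∏_{m < k} (1 + a_m cos (2 π n_m x))` of a Riesz product. -/
def rieszPartialProduct (a : ℕ → ℝ) (n : ℕ → ℕ) (k : ℕ) (x : ℝ) : ℝ :=
  ∏ m ∈ Finset.range k, (1 + a m * Real.cos (2 * Real.pi * (n m : ℝ) * x))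

theorem continuous_rieszPartialProduct (a : ℕ → ℝ) (n : ℕ → ℕ) (k : ℕ) :
    Continuous (rieszPartialProduct a n k) := by
  unfold rieszPartialProduct
  fun_prop

/-- When all `|a_m| ≤ 1` the partial products are nonnegative, so nothing is lost by using
`ENNReal.ofReal` in the definition of `rieszPartialMeasure` below. -/
theorem rieszPartialProduct_nonneg (a : ℕ → ℝ) (n : ℕ → ℕ) (ha : ∀ m, |a m| ≤ 1)
    (k : ℕ) (x : ℝ) : 0 ≤ rieszPartialProduct a n k x := by
  refine Finset.prod_nonneg fun m _ => ?_
  have h : |a m * Real.cos (2 * Real.pi * (n m : ℝ) * x)| ≤ 1 := by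
    rw [abs_mul]
    exact mul_le_one₀ (ha m) (abs_nonneg _) (Real.abs_cos_le_one _)
  linarith [(abs_le.mp h).1]

/-- Lebesgue measure on `[0,1]`, regarded as a measure on `ℝ`. -/
def unitLebesgue : Measure ℝ := volume.restrict (Set.Icc (0 : ℝ) 1)

/-- The measure `p_k(x) dx` on `[0,1]`, regarded as a finite measure on `ℝ`, where `p_k` is the
`k`-th partial product of the Riesz product. -/
def rieszPartialMeasure (a : ℕ → ℝ) (n : ℕ → ℕ) (k : ℕ) : FiniteMeasure ℝ :=
  ⟨unitLebesgue.withDensity (fun x => ENNReal.ofReal (rieszPartialProduct a n k x)),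
    isFiniteMeasure_withDensity_ofReal
      ((continuous_rieszPartialProduct a n k).integrableOn_Icc (μ := volume)).2⟩

/-- `μ` is the Riesz product measure `∏ (1 + a_m cos (2 π n_m x))` on `[0,1]`, regarded as a
measure on `ℝ`: the coefficients satisfy `a_m ≠ 0` and `|a_m| ≤ 1`, the frequencies are positive
and lacunary with ratio at least `3`, and `μ` is the weak limit of the measures `p_k(x) dx` on
`[0,1]`. (Such a limit is unique and is automatically carried by `[0,1]`.) -/
structure IsRieszProductMeasure (a : ℕ → ℝ) (n : ℕ → ℕ) (μ : ProbabilityMeasure ℝ) : Prop where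
  coeff_ne_zero : ∀ m, a m ≠ 0
  abs_coeff_le_one : ∀ m, |a m| ≤ 1
  freq_pos : ∀ m, 0 < n m
  lacunary : ∀ m, 3 * n m ≤ n (m + 1)
  tendsto_partial : Tendsto (rieszPartialMeasure a n) atTop (𝓝 μ.toFiniteMeasure)

/-- The contraction `C_t μ`, that is `(C_t μ)(A) = ∫ 1_A(t s) dμ(s)`. -/
def contraction (t : ℝ) (μ : Measure ℝ) : Measure ℝ :=
  μ.map (fun s => t * s)

/-- The convolution `(ν ∗ f)(x) = ∫ f(x - y) dν(y)`. -/
def convMeasure (ν : Measure ℝ) (f : ℝ → ℂ) (x : ℝ) : ℂ :=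
  ∫ y, f (x - y) ∂ν

/-- The square function `(∑_k |C_{t_k} λ ∗ f (x) - C_{t_k} μ ∗ f (x)|²)^{1/2}`, with values in
`[0, ∞]`, where `λ` is Lebesgue measure on `[0,1]`. -/
def squareFunction (μ : Measure ℝ) (t : ℕ → ℝ) (f : ℝ → ℂ) (x : ℝ) : ℝ≥0∞ :=
  (∑' k, ‖convMeasure (contraction (t k) unitLebesgue) f x
      - convMeasure (contraction (t k) μ) f x‖ₑ ^ 2) ^ (1 / 2 : ℝ)

end

/-!
The measure is the Riesz product with frequencies `n_m = 2 ^ (4 * 16 ^ m)`, and the contraction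
parameters are `t_k = 2 ^ (-16 ^ (k + 1))`. By Plancherel's theorem the `L²` bound reduces to a
bound, uniform in `ξ`, for `∑ₖ |λ̂(t_k ξ) - μ̂(t_k ξ)|²` (`eLpNorm_squareFunction_le`).

*Decay of the multiplier.* Let `p_m` be the `m`-th partial product on `[0,1]` and `p̂_m` its
Fourier transform. Since `λ̂(ξ) = (e^{-2πiξ} - 1) / (-2πiξ)` and the numerator has period `1`, the
`3 ^ m` integer translates of `λ̂` that make up `p̂_m` all have numerator of modulus at most `8
min(1, |ξ|)`, which yields `norm_rieszFourier_mul_le`. The increment `p̂_{m+1}(ξ) - p̂_m(ξ)` is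
the mean of `p̂_m(ξ - n_m)` and `p̂_m(ξ + n_m)`; unless `|ξ|` is within a factor `2` of `n_m` it
is therefore at most `32 · 2 ^ m min(1, |ξ|) / max(n_m, |ξ|)`. As `n_m` grows fast, summing over
`m` gives `|λ̂(ξ) - μ̂(ξ)| ≤ 64 min(|ξ|, 1/|ξ|)^{1/2}` for every `ξ` that is not within a factor
`2` of some `±n_m` (`norm_fourierMultiplier_sub_le`). The same increments show that `p̂_m`
converges pointwise, so that Prokhorov's and Lévy's theorems produce `μ`
(`exists_tendsto_rieszPartialMeasure`).

*One resonance.* The multiplier does not tend to zero, since `μ̂(n_m) = 1/2`. But if `t_k ξ` and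
`t_j ξ` are both within a factor `2` of frequencies `n_m` and `n_l`, then `n_m / t_k` and `n_l /
t_j` are comparable, and by the choice of the exponents this forces `k = j` (`Resonant.unique`).
So at most one term of the sum is resonant, and it is at most `4`; the remaining terms are
dominated by a two-sided geometric series.

*Transference to `L²`.* Convolution with a probability measure is a contraction of `L²` by
Jensen's inequality and Tonelli's theorem. For Schwartz functions it is the multiplication of the
Fourier transform by `ν̂`, and this passes to all of `L²` by density
(`convMeasure_ae_eq_multiplierOp`).
-/

noncomputable section

namespace RieszSquareFunction

/-! ### Fourier transforms of the partial products -/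

/-- The Fourier transform `∫₀¹ p_k(x) e^{-2πiξx} dx` of the `k`-th partial product `p_k` of the
Riesz product with all coefficients `1`, at a real frequency `ξ`. -/
def rieszFourier (n : ℕ → ℕ) (k : ℕ) (ξ : ℝ) : ℂ :=
  ∫ x in (0 : ℝ)..1,
    (rieszPartialProduct (fun _ => 1) n k x : ℂ) *
      Complex.exp (-(2 * Real.pi * ξ * x : ℝ) * Complex.I)

theorem intervalIntegrable_rieszFourier (n : ℕ → ℕ) (k : ℕ) (ξ : ℝ) :
    IntervalIntegrable (fun x : ℝ => (rieszPartialProduct (fun _ => 1) n k x : ℂ) *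
      Complex.exp (-(2 * Real.pi * ξ * x : ℝ) * Complex.I)) volume 0 1 := by
  have := continuous_rieszPartialProduct (fun _ => 1) n k
  apply Continuous.intervalIntegrable
  fun_prop

theorem rieszFourier_succ (n : ℕ → ℕ) (k : ℕ) (ξ : ℝ) :
    rieszFourier n (k + 1) ξ = rieszFourier n k ξ +
      (rieszFourier n k (ξ - n k) + rieszFourier n k (ξ + n k)) / 2 := by
  unfold rieszFourier
  rw [← intervalIntegral.integral_add (intervalIntegrable_rieszFourier n k _)
      (intervalIntegrable_rieszFourier n k _), ← intervalIntegral.integral_div,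
    ← intervalIntegral.integral_add (intervalIntegrable_rieszFourier n k _)
      (((intervalIntegrable_rieszFourier n k _).add
        (intervalIntegrable_rieszFourier n k _)).div_const _)]
  refine intervalIntegral.integral_congr fun x _ => ?_
  have h : rieszPartialProduct (fun _ => 1) n (k + 1) x =
      rieszPartialProduct (fun _ => 1) n k x * (1 + Real.cos (2 * Real.pi * (n k : ℝ) * x)) := by
    simp [rieszPartialProduct, Finset.prod_range_succ]
  have h1 : Complex.exp (-(2 * Real.pi * (ξ - n k) * x : ℝ) * Complex.I) =
      Complex.exp (-(2 * Real.pi * ξ * x : ℝ) * Complex.I) *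
        Complex.exp ((2 * Real.pi * n k * x : ℝ) * Complex.I) := by
    rw [← Complex.exp_add]; congr 1; push_cast; ring
  have h2 : Complex.exp (-(2 * Real.pi * (ξ + n k) * x : ℝ) * Complex.I) =
      Complex.exp (-(2 * Real.pi * ξ * x : ℝ) * Complex.I) *
        Complex.exp (-(2 * Real.pi * n k * x : ℝ) * Complex.I) := by
    rw [← Complex.exp_add]; congr 1; push_cast; ring
  simp only [h, h1, h2]
  rw [Complex.ofReal_mul, Complex.ofReal_add, Complex.ofReal_one, Complex.ofReal_cos, Complex.cos]
  ring

/-- `|e^{-2πiξ} - 1|`, the numerator of the Fourier transform of Lebesgue measure on `[0,1]`. -/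
def unitPhase (ξ : ℝ) : ℝ := ‖Complex.exp (-(2 * Real.pi * ξ : ℝ) * Complex.I) - 1‖

theorem unitPhase_nonneg (ξ : ℝ) : 0 ≤ unitPhase ξ := norm_nonneg _

theorem unitPhase_add_nat (ξ : ℝ) (p : ℕ) : unitPhase (ξ + p) = unitPhase ξ := by
  unfold unitPhase
  have : (-(2 * Real.pi * (ξ + p) : ℝ) * Complex.I) =
      (-(2 * Real.pi * ξ : ℝ) * Complex.I) - p * (2 * Real.pi * Complex.I) := by
    push_cast; ring
  rw [this, Complex.exp_sub, Complex.exp_nat_mul_two_pi_mul_I, div_one]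

theorem unitPhase_sub_nat (ξ : ℝ) (p : ℕ) : unitPhase (ξ - p) = unitPhase ξ := by
  rw [← unitPhase_add_nat (ξ - p) p, sub_add_cancel]

theorem unitPhase_zero : unitPhase 0 = 0 := by simp [unitPhase]

theorem unitPhase_le (ξ : ℝ) : unitPhase ξ ≤ 8 * min 1 |ξ| := by
  unfold unitPhase
  rw [mul_min_of_nonneg _ _ (by norm_num)]
  refine le_min ?_ ?_
  · refine (norm_sub_le _ _).trans ?_
    rw [← Complex.ofReal_neg, Complex.norm_exp_ofReal_mul_I]
    norm_num
  · have := Real.norm_exp_I_mul_ofReal_sub_one_le (x := -(2 * Real.pi * ξ))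
    rw [mul_comm Complex.I, Complex.ofReal_neg] at this
    refine this.trans ?_
    rw [norm_neg, Real.norm_eq_abs, abs_mul, abs_of_pos Real.two_pi_pos]
    have := Real.pi_lt_four
    gcongr
    linarith

theorem norm_rieszFourier_zero_mul_le (n : ℕ → ℕ) (ξ : ℝ) :
    ‖rieszFourier n 0 ξ‖ * |ξ| ≤ unitPhase ξ := by
  rcases eq_or_ne ξ 0 with rfl | hξ
  · simp [unitPhase_nonneg]
  have hc : (-(2 * Real.pi * ξ : ℝ) * Complex.I) ≠ 0 := by
    simp [hξ, Real.pi_ne_zero]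
  have h : rieszFourier n 0 ξ = (Complex.exp (-(2 * Real.pi * ξ : ℝ) * Complex.I) - 1) /
      (-(2 * Real.pi * ξ : ℝ) * Complex.I) := by
    have := integral_exp_mul_complex (a := 0) (b := 1) hc
    simp only [Complex.ofReal_one, mul_one, Complex.ofReal_zero, mul_zero, Complex.exp_zero] at this
    rw [← this]
    refine intervalIntegral.integral_congr fun x _ => ?_
    simp only [rieszPartialProduct, Finset.range_zero, Finset.prod_empty, Complex.ofReal_one,
      one_mul]
    congr 1; push_cast; ring
  rw [h, norm_div, ← unitPhase, norm_mul, norm_neg, Complex.norm_I, mul_one, Complex.norm_real,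
    Real.norm_eq_abs, abs_mul, abs_of_pos Real.two_pi_pos, div_mul_eq_mul_div,
    div_le_iff₀ (by positivity)]
  have := Real.pi_gt_three
  have h0 := unitPhase_nonneg ξ
  gcongr
  exact le_mul_of_one_le_left (abs_nonneg _) (by linarith)

/-- Off the interval `[-N, N]` with `N = n_0 + ⋯ + n_{k-1}` containing its frequencies, the
`k`-th partial product has a Fourier transform that decays like that of Lebesgue measure. The
numerator has period `1`, so it is common to all `3 ^ k` translates that make up the transform. -/
theorem norm_rieszFourier_mul_le (n : ℕ → ℕ) (k : ℕ) (ξ : ℝ)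
    (hξ : (∑ m ∈ Finset.range k, (n m : ℝ)) < |ξ|) :
    ‖rieszFourier n k ξ‖ * (|ξ| - ∑ m ∈ Finset.range k, (n m : ℝ)) ≤ 2 ^ k * unitPhase ξ := by
  induction k generalizing ξ with
  | zero => simpa using norm_rieszFourier_zero_mul_le n ξ
  | succ k ih =>
    rw [Finset.sum_range_succ] at hξ ⊢
    set N := ∑ m ∈ Finset.range k, (n m : ℝ)
    have hn : (0 : ℝ) ≤ n k := Nat.cast_nonneg _
    have key : ∀ η : ℝ, |ξ| - n k ≤ |η| → unitPhase η = unitPhase ξ →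
        ‖rieszFourier n k η‖ * (|ξ| - (N + n k)) ≤ 2 ^ k * unitPhase ξ := by
      intro η h1 h2
      rw [← h2]
      refine le_trans ?_ (ih η (by linarith))
      exact mul_le_mul_of_nonneg_left (by linarith) (norm_nonneg _)
    have h0 := key ξ (by linarith) rfl
    have h1 := key (ξ - n k) (by
      have := abs_sub_abs_le_abs_sub ξ (n k); rwa [Nat.abs_cast] at this) (unitPhase_sub_nat _ _)
    have h2 := key (ξ + n k) (by
      have := abs_sub_abs_le_abs_add ξ (n k); rwa [Nat.abs_cast] at this) (unitPhase_add_nat _ _)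
    have h3 : ‖rieszFourier n (k + 1) ξ‖ ≤ ‖rieszFourier n k ξ‖ +
        (‖rieszFourier n k (ξ - n k)‖ + ‖rieszFourier n k (ξ + n k)‖) / 2 := by
      rw [rieszFourier_succ]
      refine (norm_add_le _ _).trans ?_
      rw [norm_div, Complex.norm_ofNat]
      gcongr
      exact norm_add_le _ _
    have h4 : 0 ≤ |ξ| - (N + n k) := by linarith
    have h5 := mul_le_mul_of_nonneg_right h3 h4
    rw [pow_succ]
    linarith

/-- The increment of the Fourier transform from one partial product to the next is small away
from the new frequency `n_m`, provided `n_m` dominates the earlier ones. -/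
theorem norm_rieszFourier_succ_sub_le (n : ℕ → ℕ) (m : ℕ) (hn : 0 < n m)
    (hN : 4 * (∑ i ∈ Finset.range m, (n i : ℝ)) ≤ n m) (ξ : ℝ)
    (hξ : 2 * |ξ| ≤ n m ∨ 2 * n m ≤ |ξ|) :
    ‖rieszFourier n (m + 1) ξ - rieszFourier n m ξ‖ ≤
      32 * 2 ^ m * (min 1 |ξ| / max (n m : ℝ) |ξ|) := by
  set N := ∑ i ∈ Finset.range m, (n i : ℝ)
  have hn' : (0 : ℝ) < n m := Nat.cast_pos.2 hn
  set M := max (n m : ℝ) |ξ|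
  have hM : 0 < M := lt_max_of_lt_left hn'
  have key : ∀ η : ℝ, M / 2 ≤ |η| → unitPhase η = unitPhase ξ →
      ‖rieszFourier n m η‖ ≤ 2 ^ m * (8 * min 1 |ξ|) / (M / 4) := by
    intro η h1 h2
    have h3 : M / 4 ≤ |η| - N := by
      have : (n m : ℝ) ≤ M := le_max_left _ _
      linarith
    have h4 := norm_rieszFourier_mul_le n m η (by linarith : N < |η|)
    rw [le_div_iff₀ (by positivity)]
    rw [h2] at h4
    calc _ ≤ ‖rieszFourier n m η‖ * (|η| - N) := by gcongr
      _ ≤ _ := h4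
      _ ≤ _ := by gcongr; exact unitPhase_le ξ
  have hM2 : M / 2 ≤ |(|ξ| - n m)| := by
    rcases hξ with h | h
    · have : M = n m := max_eq_left (by linarith [abs_nonneg ξ])
      rw [abs_of_nonpos (by linarith [abs_nonneg ξ]), this]; linarith
    · have : M = |ξ| := max_eq_right (by linarith)
      rw [abs_of_nonneg (by linarith), this]; linarith
  have h1 := key (ξ - n m) (hM2.trans (by
    simpa using abs_abs_sub_abs_le_abs_sub ξ (n m : ℝ))) (unitPhase_sub_nat _ _)
  have h2 := key (ξ + n m) (hM2.trans (by
    simpa using abs_abs_sub_abs_le_abs_sub ξ (-(n m : ℝ)))) (unitPhase_add_nat _ _)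
  rw [rieszFourier_succ, add_sub_cancel_left, norm_div, Complex.norm_ofNat]
  have h3 := norm_add_le (rieszFourier n m (ξ - n m)) (rieszFourier n m (ξ + n m))
  calc _ ≤ 2 ^ m * (8 * min 1 |ξ|) / (M / 4) := by linarith
    _ = _ := by field_simp; ring

/-- At a positive integer frequency beyond `n_0 + ⋯ + n_{k-1}` the coefficient vanishes, so every
partial product has integral `1`. -/
theorem rieszFourier_apply_zero (n : ℕ → ℕ)
    (hN : ∀ m, (∑ i ∈ Finset.range m, (n i : ℝ)) < n m) (k : ℕ) : rieszFourier n k 0 = 1 := by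
  induction k with
  | zero => simp [rieszFourier, rieszPartialProduct]
  | succ k ih =>
    have key : ∀ η : ℝ, |η| = n k → unitPhase η = unitPhase 0 → rieszFourier n k η = 0 := by
      intro η h1 h2
      have := norm_rieszFourier_mul_le n k η (h1 ▸ hN k)
      rw [h2, unitPhase_zero, mul_zero, h1] at this
      have h3 := hN k
      exact norm_le_zero_iff.1 (nonpos_of_mul_nonpos_left this (by linarith))
    rw [rieszFourier_succ, ih, key _ (by simp) (unitPhase_sub_nat _ _),
      key _ (by simp) (unitPhase_add_nat _ _)]
    simp

/-! ### Fourier transforms of measures -/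

/-- The Fourier transform of a measure `ν` on `ℝ`, with the normalization
`ξ ↦ ∫ e^{-2πiξx} dν(x)` of Mathlib's `𝓕`. -/
def fourierMultiplier (ν : Measure ℝ) (ξ : ℝ) : ℂ := charFun ν (-(2 * Real.pi * ξ))

theorem fourierMultiplier_rieszPartialMeasure (n : ℕ → ℕ) (k : ℕ) (ξ : ℝ) :
    fourierMultiplier (rieszPartialMeasure (fun _ => 1) n k : Measure ℝ) ξ =
      rieszFourier n k ξ := by
  have hc := continuous_rieszPartialProduct (fun _ => 1) n k
  have hm : Measurable fun x => (rieszPartialProduct (fun _ => 1) n k x).toNNReal :=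
    hc.measurable.real_toNNReal
  rw [fourierMultiplier, charFun_apply_real]
  change ∫ x, _ ∂(unitLebesgue.withDensity fun x =>
    ((rieszPartialProduct (fun _ => 1) n k x).toNNReal : ℝ≥0∞)) = _
  rw [integral_withDensity_eq_integral_smul hm, unitLebesgue, integral_Icc_eq_integral_Ioc,
    ← intervalIntegral.integral_of_le zero_le_one]
  refine intervalIntegral.integral_congr fun x _ => ?_
  have h := rieszPartialProduct_nonneg (fun _ => 1) n (by simp) k x
  simp only [NNReal.smul_def, Real.coe_toNNReal _ h, Complex.real_smul]
  congr 2
  push_cast; ring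

theorem rieszPartialMeasure_zero (n : ℕ → ℕ) :
    (rieszPartialMeasure (fun _ => 1) n 0 : Measure ℝ) = unitLebesgue := by
  change unitLebesgue.withDensity (fun x => ENNReal.ofReal (rieszPartialProduct _ n 0 x)) = _
  simp [rieszPartialProduct]

theorem norm_fourierMultiplier_le_one (ν : Measure ℝ) [IsProbabilityMeasure ν] (ξ : ℝ) :
    ‖fourierMultiplier ν ξ‖ ≤ 1 :=
  norm_charFun_le_one _

theorem continuous_fourierMultiplier (ν : Measure ℝ) [IsFiniteMeasure ν] :
    Continuous (fourierMultiplier ν) := by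
  unfold fourierMultiplier
  exact continuous_charFun.comp (by fun_prop)

theorem fourierMultiplier_contraction (ν : Measure ℝ) (t ξ : ℝ) :
    fourierMultiplier (contraction t ν) ξ = fourierMultiplier ν (t * ξ) := by
  unfold fourierMultiplier contraction
  rw [charFun_map_mul]
  congr 1
  ring

/-! ### Weak convergence of the partial products -/

theorem isProbabilityMeasure_rieszPartialMeasure (n : ℕ → ℕ)
    (hN : ∀ m, (∑ i ∈ Finset.range m, (n i : ℝ)) < n m) (k : ℕ) :
    IsProbabilityMeasure (rieszPartialMeasure (fun _ => 1) n k : Measure ℝ) := by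
  have h := fourierMultiplier_rieszPartialMeasure n k 0
  rw [rieszFourier_apply_zero n hN, fourierMultiplier, mul_zero, neg_zero, charFun_zero] at h
  have h1 : (rieszPartialMeasure (fun _ => 1) n k : Measure ℝ).real Set.univ = 1 := by
    exact_mod_cast h
  exact ⟨by rwa [measureReal_def, ENNReal.toReal_eq_one_iff] at h1⟩

theorem rieszPartialMeasure_compl_Icc (n : ℕ → ℕ) (k : ℕ) :
    (rieszPartialMeasure (fun _ => 1) n k : Measure ℝ) (Set.Icc 0 1)ᶜ = 0 := by
  refine withDensity_absolutelyContinuous unitLebesgue _ ?_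
  rw [unitLebesgue, Measure.restrict_apply measurableSet_Icc.compl]
  simp

/-- If the Fourier transforms of the partial products converge pointwise, then the partial
products converge weakly: they are carried by `[0,1]`, hence have a weak cluster point, whose
Fourier transform is the pointwise limit, and Lévy's theorem upgrades this to convergence. -/
theorem exists_tendsto_rieszPartialMeasure (n : ℕ → ℕ)
    (hN : ∀ m, (∑ i ∈ Finset.range m, (n i : ℝ)) < n m)
    (hlim : ∀ ξ, ∃ l, Tendsto (fun k => rieszFourier n k ξ) atTop (𝓝 l)) :
    ∃ μ : ProbabilityMeasure ℝ,
      Tendsto (rieszPartialMeasure (fun _ => 1) n) atTop (𝓝 μ.toFiniteMeasure) := by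
  have hprob := isProbabilityMeasure_rieszPartialMeasure n hN
  let P : ℕ → ProbabilityMeasure ℝ := fun k => ⟨rieszPartialMeasure (fun _ => 1) n k, hprob k⟩
  have hchar : ∀ s, ∃ l, Tendsto (fun k => charFun (P k : Measure ℝ) s) atTop (𝓝 l) := by
    intro s
    obtain ⟨l, hl⟩ := hlim (-(s / (2 * Real.pi)))
    refine ⟨l, hl.congr fun k => ?_⟩
    rw [← fourierMultiplier_rieszPartialMeasure, fourierMultiplier]
    congr 1
    field_simp
  have htight : IsTightMeasureSet {(μ : Measure ℝ) | μ ∈ Set.range P} := by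
    rw [isTightMeasureSet_iff_exists_isCompact_measure_compl_le]
    refine fun ε _ => ⟨Set.Icc 0 1, isCompact_Icc, ?_⟩
    rintro _ ⟨_, ⟨k, rfl⟩, rfl⟩
    exact (rieszPartialMeasure_compl_Icc n k).trans_le zero_le
  obtain ⟨μ, -, hμ⟩ := (isCompact_closure_of_isTightMeasureSet htight).ultrafilter_le_nhds
    ((hyperfilter ℕ).map P)
    (le_principal_iff.2 (mem_of_superset (range_mem_map) subset_closure))
  have hμ : Tendsto P (hyperfilter ℕ : Filter ℕ) (𝓝 μ) := hμ
  have hle : (hyperfilter ℕ : Filter ℕ) ≤ atTop := Nat.hyperfilter_le_atTop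
  have key : ∀ s, Tendsto (fun k => charFun (P k : Measure ℝ) s) atTop
      (𝓝 (charFun (μ : Measure ℝ) s)) := by
    intro s
    obtain ⟨l, hl⟩ := hchar s
    have h1 : Tendsto (fun k => charFun (P k : Measure ℝ) s) (hyperfilter ℕ : Filter ℕ)
        (𝓝 (charFun (μ : Measure ℝ) s)) := by
      rw [ProbabilityMeasure.tendsto_iff_forall_integral_rclike_tendsto ℂ] at hμ
      simp_rw [charFun_eq_integral_innerProbChar]
      exact hμ (BoundedContinuousFunction.innerProbChar s)
    rwa [tendsto_nhds_unique h1 (hl.mono_left hle)]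
  have h2 := ProbabilityMeasure.tendsto_of_tendsto_charFun key
  refine ⟨μ, ?_⟩
  rw [ProbabilityMeasure.tendsto_nhds_iff_toFiniteMeasure_tendsto_nhds] at h2
  exact h2

/-! ### The frequencies and the decay of the multiplier -/

/-- The frequencies `n_m = 2 ^ (4 * 16 ^ m)`. -/
def freq (m : ℕ) : ℕ := 2 ^ (4 * 16 ^ m)

theorem freq_pos (m : ℕ) : 0 < freq m := by unfold freq; positivity

theorem eight_mul_freq_le (m : ℕ) : 8 * freq m ≤ freq (m + 1) := by
  have h : 8 * freq m = 2 ^ (4 * 16 ^ m + 3) := by rw [freq, pow_add]; ring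
  rw [h]
  refine Nat.pow_le_pow_right two_pos ?_
  have : 1 ≤ 16 ^ m := Nat.one_le_pow _ _ (by norm_num)
  rw [pow_succ]
  omega

theorem sixteen_pow_le_freq (m : ℕ) : 16 ^ m ≤ freq m := by
  have : (16 : ℕ) ^ m = 2 ^ (4 * m) := by rw [pow_mul]; norm_num
  rw [this]
  exact Nat.pow_le_pow_right two_pos (by gcongr; exact (Nat.lt_pow_self (by norm_num)).le)

theorem four_mul_sum_freq_le (m : ℕ) : 4 * (∑ i ∈ Finset.range m, (freq i : ℝ)) ≤ freq m := by
  induction m with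
  | zero => simp
  | succ m ih =>
    have : (8 * freq m : ℝ) ≤ freq (m + 1) := by exact_mod_cast eight_mul_freq_le m
    rw [Finset.sum_range_succ]
    have := (freq m).cast_nonneg (α := ℝ)
    linarith

theorem sum_freq_lt (m : ℕ) : (∑ i ∈ Finset.range m, (freq i : ℝ)) < freq m := by
  have h1 := four_mul_sum_freq_le m
  have h2 : (0 : ℝ) < freq m := Nat.cast_pos.2 (freq_pos m)
  have h3 : 0 ≤ ∑ i ∈ Finset.range m, (freq i : ℝ) := by positivity
  linarith

/-- Splitting the decay evenly between the frequency `N` and the point `x`. -/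
theorem min_div_max_le {q N x : ℝ} (hq : 1 ≤ q) (hN : q ^ 2 ≤ N) (hx : 0 ≤ x) :
    min 1 x / max N x ≤ q⁻¹ * √(min x x⁻¹) := by
  have hN1 : 1 ≤ N := le_trans (by nlinarith) hN
  have hM : 0 < max N x := lt_max_of_lt_left (by linarith)
  rcases hx.eq_or_lt with rfl | hx
  · simp
  rw [← div_eq_inv_mul, le_div_iff₀ (by linarith)]
  refine Real.le_sqrt_of_sq_le ?_
  rw [mul_pow, div_pow, div_mul_eq_mul_div, div_le_iff₀ (by positivity)]
  rcases le_total x 1 with h | h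
  · rw [min_eq_right h, min_eq_left (h.trans ((one_le_inv₀ hx).2 h)), max_eq_left (h.trans hN1)]
    calc x ^ 2 * q ^ 2 ≤ (x * 1) * N := by rw [sq x]; gcongr
      _ ≤ x * N ^ 2 := by rw [mul_one]; gcongr; nlinarith
  · rw [min_eq_left h, min_eq_right ((inv_le_one_of_one_le₀ h).trans h), one_pow, one_mul,
      ← div_eq_inv_mul, le_div_iff₀ hx]
    calc q ^ 2 * x ≤ N * x := by gcongr
      _ ≤ max N x * max N x := by gcongr <;> simp
      _ = _ := (sq _).symm

theorem norm_rieszFourier_freq_succ_sub_le (m : ℕ) (ξ : ℝ)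
    (hξ : 2 * |ξ| ≤ freq m ∨ 2 * freq m ≤ |ξ|) :
    ‖rieszFourier freq (m + 1) ξ - rieszFourier freq m ξ‖ ≤
      32 * √(min |ξ| |ξ|⁻¹) * (1 / 2) ^ m := by
  refine (norm_rieszFourier_succ_sub_le freq m (freq_pos m) (four_mul_sum_freq_le m) ξ hξ).trans ?_
  have h : ((4 : ℝ) ^ m) ^ 2 ≤ freq m := by
    rw [← pow_mul, mul_comm, pow_mul]; norm_num; exact_mod_cast sixteen_pow_le_freq m
  have := min_div_max_le (one_le_pow₀ (by norm_num) : (1 : ℝ) ≤ 4 ^ m) h (abs_nonneg ξ)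
  calc _ ≤ 32 * 2 ^ m * (((4 : ℝ) ^ m)⁻¹ * √(min |ξ| |ξ|⁻¹)) := by gcongr
    _ = _ := by
      have : (2 : ℝ) ^ m * ((4 : ℝ) ^ m)⁻¹ = (1 / 2) ^ m := by
        rw [← div_eq_mul_inv, ← div_pow]; norm_num
      rw [← this]; ring

theorem eventually_le_freq (ξ : ℝ) : ∀ᶠ m in atTop, 2 * |ξ| ≤ freq m := by
  have h : Tendsto (fun m => (16 : ℝ) ^ m) atTop atTop :=
    tendsto_pow_atTop_atTop_of_one_lt (by norm_num)
  filter_upwards [h.eventually_ge_atTop (2 * |ξ|)] with m hm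
  exact hm.trans (by exact_mod_cast sixteen_pow_le_freq m)

theorem exists_tendsto_rieszFourier_freq (ξ : ℝ) :
    ∃ l, Tendsto (fun k => rieszFourier freq k ξ) atTop (𝓝 l) := by
  have hs : Summable fun m => rieszFourier freq (m + 1) ξ - rieszFourier freq m ξ := by
    refine Summable.of_norm_bounded_eventually_nat
      (summable_geometric_two.mul_left (32 * √(min |ξ| |ξ|⁻¹))) ?_
    filter_upwards [eventually_le_freq ξ] with m hm
    exact norm_rieszFourier_freq_succ_sub_le m ξ (Or.inl hm)
  have h := hs.hasSum.tendsto_sum_nat.add_const (rieszFourier freq 0 ξ)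
  refine ⟨_, h.congr fun k => ?_⟩
  rw [Finset.sum_range_sub (fun k => rieszFourier freq k ξ), sub_add_cancel]

theorem exists_isRieszProductMeasure_freq :
    ∃ μ : ProbabilityMeasure ℝ, IsRieszProductMeasure (fun _ => 1) freq μ := by
  obtain ⟨μ, hμ⟩ := exists_tendsto_rieszPartialMeasure freq sum_freq_lt
    exists_tendsto_rieszFourier_freq
  exact ⟨μ, by simp, by simp, freq_pos,
    fun m => (Nat.mul_le_mul_right _ (by norm_num)).trans (eight_mul_freq_le m), hμ⟩

theorem tendsto_rieszFourier {n : ℕ → ℕ} {μ : ProbabilityMeasure ℝ}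
    (hμ : IsRieszProductMeasure (fun _ => 1) n μ) (ξ : ℝ) :
    Tendsto (fun k => rieszFourier n k ξ) atTop (𝓝 (fourierMultiplier μ ξ)) := by
  have h := hμ.tendsto_partial
  rw [FiniteMeasure.tendsto_iff_forall_integral_rclike_tendsto ℂ] at h
  simp_rw [← fourierMultiplier_rieszPartialMeasure, fourierMultiplier,
    charFun_eq_integral_innerProbChar]
  exact h (BoundedContinuousFunction.innerProbChar _)

theorem norm_fourierMultiplier_sub_le {μ : ProbabilityMeasure ℝ}
    (hμ : IsRieszProductMeasure (fun _ => 1) freq μ) (ξ : ℝ)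
    (hξ : ∀ m, 2 * |ξ| ≤ freq m ∨ 2 * freq m ≤ |ξ|) :
    ‖fourierMultiplier unitLebesgue ξ - fourierMultiplier μ ξ‖ ≤ 64 * √(min |ξ| |ξ|⁻¹) := by
  rw [norm_sub_rev, ← rieszPartialMeasure_zero freq, fourierMultiplier_rieszPartialMeasure]
  refine le_of_tendsto ((tendsto_rieszFourier hμ ξ).sub_const _).norm (Eventually.of_forall ?_)
  intro k
  rw [← Finset.sum_range_sub (fun k => rieszFourier freq k ξ)]
  refine (norm_sum_le _ _).trans ((Finset.sum_le_sum fun m _ =>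
    norm_rieszFourier_freq_succ_sub_le m ξ (hξ m)).trans ?_)
  rw [← Finset.mul_sum]
  have := sum_geometric_two_le k
  have h0 : 0 ≤ 32 * √(min |ξ| |ξ|⁻¹) := by positivity
  nlinarith

/-! ### The contraction parameters and the sum over contractions -/

/-- The contraction parameters `t_k = 2 ^ (-16 ^ (k + 1))`. -/
def scale (k : ℕ) : ℝ := ((2 : ℝ) ^ (16 ^ (k + 1)))⁻¹

theorem scale_pos (k : ℕ) : 0 < scale k := by unfold scale; positivity

theorem strictMono_sixteen_pow_succ : StrictMono fun k : ℕ => 16 ^ (k + 1) :=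
  (pow_right_strictMono₀ (by norm_num)).comp (strictMono_id.add_const 1)

theorem strictAnti_scale : StrictAnti scale := by
  intro i j hij
  unfold scale
  gcongr
  · norm_num
  · norm_num

theorem tendsto_scale : Tendsto scale atTop (𝓝 0) :=
  tendsto_inv_atTop_zero.comp ((tendsto_pow_atTop_atTop_of_one_lt one_lt_two).comp
    strictMono_sixteen_pow_succ.tendsto_atTop)

theorem not_lt_of_sixteen_pow_eq {m k l j : ℕ}
    (h : 16 ^ m + 4 * 16 ^ k = 16 ^ l + 4 * 16 ^ j) : ¬ k < j := by
  intro hkj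
  have mono : ∀ {a b : ℕ}, a ≤ b → 16 ^ a ≤ 16 ^ b := fun hab =>
    Nat.pow_le_pow_right (by norm_num) hab
  have step : ∀ {a b : ℕ}, a < b → 16 * 16 ^ a ≤ 16 ^ b := fun hab => by
    rw [← pow_succ']; exact mono hab
  have pos : ∀ a : ℕ, 0 < 16 ^ a := fun a => by positivity
  have h1 := step hkj
  have := pos k
  rcases le_or_gt m j with hm | hm
  · have := mono hm
    have := pos l
    omega
  · have := step hm
    rcases le_or_gt m l with hl | hl
    · have := mono hl
      omega
    · have := step hl
      omega

/-- The contracted point `t_k ξ` is resonant if it comes within a factor `2` of a frequency. -/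
def Resonant (ξ : ℝ) (k : ℕ) : Prop :=
  ∃ m, (freq m : ℝ) < 2 * |scale k * ξ| ∧ |scale k * ξ| < 2 * freq m

/-- The ratios of the frequencies and the ratios of the contraction parameters are never
comparable, so at most one contraction takes a given point near a frequency. -/
theorem Resonant.unique {ξ : ℝ} {k j : ℕ} (hk : Resonant ξ k) (hj : Resonant ξ j) : k = j := by
  have bound : ∀ {k : ℕ} {m : ℕ}, (freq m : ℝ) < 2 * |scale k * ξ| → |scale k * ξ| < 2 * freq m →
      (2 : ℝ) ^ (4 * 16 ^ m + 16 ^ (k + 1)) < 2 * |ξ| ∧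
      2 * |ξ| < (2 : ℝ) ^ (4 * 16 ^ m + 16 ^ (k + 1) + 2) := by
    intro k m h1 h2
    rw [abs_mul, abs_of_pos (scale_pos k), scale, ← div_eq_inv_mul] at h1 h2
    have hp : (0 : ℝ) < 2 ^ 16 ^ (k + 1) := by positivity
    rw [← mul_div_assoc, lt_div_iff₀ hp] at h1
    rw [div_lt_iff₀ hp] at h2
    rw [freq] at h1 h2
    push_cast at h1 h2
    rw [pow_add _ _ 2, pow_add]
    exact ⟨h1, by linarith⟩
  have compare : ∀ {k m j l : ℕ}, (2 : ℝ) ^ (4 * 16 ^ m + 16 ^ (k + 1)) < 2 * |ξ| →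
      2 * |ξ| < (2 : ℝ) ^ (4 * 16 ^ l + 16 ^ (j + 1) + 2) →
      4 * 16 ^ m + 16 ^ (k + 1) < 4 * 16 ^ l + 16 ^ (j + 1) + 2 := fun h1 h2 =>
    (pow_lt_pow_iff_right₀ one_lt_two).1 (h1.trans h2)
  obtain ⟨m, hm1, hm2⟩ := hk
  obtain ⟨l, hl1, hl2⟩ := hj
  obtain ⟨hm1, hm2⟩ := bound hm1 hm2
  obtain ⟨hl1, hl2⟩ := bound hl1 hl2
  have h1 := compare hm1 hl2
  have h2 := compare hl1 hm2
  -- both exponents are multiples of `4`, so being within `1` of each other they agree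
  have h : 16 ^ m + 4 * 16 ^ k = 16 ^ l + 4 * 16 ^ j := by
    rw [pow_succ, pow_succ] at h1 h2
    omega
  exact le_antisymm (not_lt.1 (not_lt_of_sixteen_pow_eq h.symm))
    (not_lt.1 (not_lt_of_sixteen_pow_eq h))

open Classical in
theorem tsum_resonant_le (ξ : ℝ) :
    ∑' k, (if Resonant ξ k then (4 : ℝ≥0∞) else 0) ≤ 4 := by
  by_cases h : ∃ k, Resonant ξ k
  · obtain ⟨k, hk⟩ := h
    have : ∀ j, Resonant ξ j ↔ j = k := fun j => ⟨fun hj => hj.unique hk, fun hj => hj ▸ hk⟩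
    simp only [this, tsum_ite_eq, le_refl]
  · push Not at h
    simp [h]

/-- A bound, uniform in `ξ`, for `∑ₖ min (t_k |ξ|) (t_k |ξ|)⁻¹`. -/
def scaleBound : ℝ≥0∞ := ∑' i : ℤ, ENNReal.ofReal (2 * (1 / 2) ^ i.natAbs)

theorem scaleBound_ne_top : scaleBound ≠ ∞ := by
  have h : Summable fun i : ℤ => (2 : ℝ) * (1 / 2) ^ i.natAbs := by
    refine Summable.mul_left _ (Summable.of_nat_of_neg ?_ ?_) <;>
      simpa using summable_geometric_two
  unfold scaleBound
  rw [← ENNReal.ofReal_tsum_of_nonneg (fun i => by positivity) h]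
  exact ENNReal.ofReal_ne_top

theorem tsum_scale_le (ξ : ℝ) :
    ∑' k, ENNReal.ofReal (min |scale k * ξ| |scale k * ξ|⁻¹) ≤ scaleBound := by
  rcases eq_or_ne ξ 0 with rfl | hξ
  · simp
  obtain ⟨e, he1, he2⟩ := exists_mem_Ico_zpow (abs_pos.2 hξ) one_lt_two
  have hinj : Function.Injective fun k : ℕ => e - (16 ^ (k + 1) : ℕ) := by
    intro i j hij
    exact strictMono_sixteen_pow_succ.injective (by simpa using hij)
  refine le_trans (ENNReal.tsum_le_tsum fun k => ?_) (ENNReal.tsum_comp_le_tsum_of_injective hinj _)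
  refine ENNReal.ofReal_le_ofReal ?_
  set i : ℤ := e - (16 ^ (k + 1) : ℕ) with hi
  have hx : |scale k * ξ| = |ξ| / (2 : ℝ) ^ (16 ^ (k + 1)) := by
    rw [abs_mul, abs_of_pos (scale_pos k), scale, ← div_eq_inv_mul]
  have h1 : (2 : ℝ) ^ i ≤ |scale k * ξ| := by
    rw [hx, hi, zpow_sub₀ two_ne_zero, zpow_natCast]; gcongr
  have h2 : |scale k * ξ| ≤ 2 * 2 ^ i := by
    rw [hx, hi, zpow_sub₀ two_ne_zero, zpow_natCast, ← mul_div_assoc]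
    rw [zpow_add_one₀ two_ne_zero, mul_comm] at he2
    gcongr
  rcases le_total i 0 with h | h
  · refine (min_le_left _ _).trans (h2.trans_eq ?_)
    rw [one_div, inv_pow, ← zpow_natCast, Int.ofNat_natAbs_of_nonpos h, zpow_neg, inv_inv]
  · refine (min_le_right _ _).trans ?_
    rw [one_div, inv_pow, ← zpow_natCast, Int.natAbs_of_nonneg h]
    have hp : (0 : ℝ) < 2 ^ i := by positivity
    calc _ ≤ ((2 : ℝ) ^ i)⁻¹ := by gcongr
      _ ≤ _ := le_mul_of_one_le_left (by positivity) one_le_two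

instance isProbabilityMeasure_unitLebesgue : IsProbabilityMeasure unitLebesgue :=
  ⟨by simp [unitLebesgue]⟩

open Classical in
/-- The pointwise bound on the Fourier side: the one resonant term is at most `2 ^ 2`, and the
others are dominated by a two-sided geometric series. -/
theorem tsum_enorm_fourierMultiplier_sub_sq_le {μ : ProbabilityMeasure ℝ}
    (hμ : IsRieszProductMeasure (fun _ => 1) freq μ) (ξ : ℝ) :
    ∑' k, ‖fourierMultiplier unitLebesgue (scale k * ξ) - fourierMultiplier μ (scale k * ξ)‖ₑ ^ 2
      ≤ 4 + 4096 * scaleBound := by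
  calc _ ≤ ∑' k, ((if Resonant ξ k then (4 : ℝ≥0∞) else 0) +
        4096 * ENNReal.ofReal (min |scale k * ξ| |scale k * ξ|⁻¹)) := by
        refine ENNReal.tsum_le_tsum fun k => ?_
        set η := scale k * ξ with hη
        rw [← ofReal_norm, ← ENNReal.ofReal_pow (norm_nonneg _)]
        split_ifs with h
        · refine le_add_right ?_
          have h1 := norm_fourierMultiplier_le_one unitLebesgue η
          have h2 := norm_fourierMultiplier_le_one (μ : Measure ℝ) η
          have h3 := norm_sub_le (fourierMultiplier unitLebesgue η) (fourierMultiplier μ η)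
          refine ENNReal.ofReal_le_of_le_toReal ?_
          rw [ENNReal.toReal_ofNat]
          have h4 := norm_nonneg (fourierMultiplier unitLebesgue η - fourierMultiplier μ η)
          nlinarith
        · rw [zero_add]
          have h1 : ∀ m, 2 * |η| ≤ freq m ∨ 2 * freq m ≤ |η| := by
            intro m
            by_contra! hc
            exact h ⟨m, hc⟩
          have h2 := norm_fourierMultiplier_sub_le hμ η h1
          rw [← ENNReal.ofReal_ofNat 4096, ← ENNReal.ofReal_mul (by norm_num)]
          refine ENNReal.ofReal_le_ofReal ((pow_le_pow_left₀ (norm_nonneg _) h2 2).trans ?_)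
          rw [mul_pow, Real.sq_sqrt (by positivity)]
          norm_num
    _ = _ := by rw [ENNReal.tsum_add, ENNReal.tsum_mul_left]
    _ ≤ _ := by
        gcongr
        · exact tsum_resonant_le ξ
        · exact tsum_scale_le ξ

/-! ### The Fourier transform on `L¹ ∩ L²` -/

open FourierTransform SchwartzMap

/-- On `L¹ ∩ L²` the inverse Fourier transform of `L²` is given by the absolutely convergent
integral: both have the same pairings with Schwartz functions. -/
theorem coeFn_fourierInv_toLp {h : ℝ → ℂ} (h1 : Integrable h) (h2 : MemLp h 2 volume) :
    (𝓕⁻ (h2.toLp h) : Lp ℂ 2 (volume : Measure ℝ)) =ᵐ[volume] 𝓕⁻ h := by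
  have hcont : Continuous (𝓕⁻ h) :=
    VectorFourier.fourierIntegral_continuous (L := -innerₗ ℝ) Real.continuous_fourierChar
      continuous_inner.neg h1
  refine ae_eq_of_integral_contDiff_smul_eq
    ((Lp.memLp _).locallyIntegrable one_le_two) hcont.locallyIntegrable fun g hg hgs => ?_
  have hgs' : HasCompactSupport fun x => (g x : ℂ) := hgs.comp_left Complex.ofReal_zero
  let φ : 𝓢(ℝ, ℂ) := hgs'.toSchwartzMap (Complex.ofRealCLM.contDiff.comp hg)
  have hφ : ∀ x, φ x = g x := fun x => rfl
  have key := congrArg (fun T => T φ) (Lp.fourierInv_toTemperedDistribution_eq (h2.toLp h))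
  simp only [TemperedDistribution.fourierInv_apply, Lp.toTemperedDistribution_apply] at key
  have flip := VectorFourier.integral_fourierIntegral_smul_eq_flip (μ := volume) (ν := volume)
    (L := -innerₗ ℝ) (f := φ) (g := h) Real.continuous_fourierChar
    continuous_inner.neg φ.integrable h1
  have hsymm : (-innerₗ ℝ : ℝ →ₗ[ℝ] ℝ →ₗ[ℝ] ℝ).flip = -innerₗ ℝ := by
    ext; simp
  rw [hsymm] at flip
  calc ∫ x, g x • (𝓕⁻ (h2.toLp h) : Lp ℂ 2 (volume : Measure ℝ)) x
      = ∫ x, φ x • (𝓕⁻ (h2.toLp h) : Lp ℂ 2 (volume : Measure ℝ)) x := by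
        simp only [hφ, Complex.real_smul, smul_eq_mul]
    _ = ∫ x, (𝓕⁻ φ) x • (h2.toLp h) x := key.symm
    _ = ∫ x, (𝓕⁻ φ) x • h x := by
        refine integral_congr_ae ?_
        filter_upwards [h2.coeFn_toLp] with x hx
        rw [hx]
    _ = ∫ x, φ x • 𝓕⁻ h x := by
        rw [fourierInv_coe]; exact flip
    _ = _ := by simp only [hφ, Complex.real_smul, smul_eq_mul]

/-! ### Convolution with a probability measure as a Fourier multiplier -/

section Convolution

variable {ν : Measure ℝ} [IsProbabilityMeasure ν] {f g : ℝ → ℂ}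

theorem aestronglyMeasurable_comp_sub (hf : AEStronglyMeasurable f volume) :
    AEStronglyMeasurable (fun p : ℝ × ℝ => f (p.1 - p.2)) (volume.prod ν) :=
  hf.comp_quasiMeasurePreserving (quasiMeasurePreserving_sub_of_right_invariant volume ν)

theorem aestronglyMeasurable_convMeasure (hf : AEStronglyMeasurable f volume) :
    AEStronglyMeasurable (convMeasure ν f) volume :=
  (aestronglyMeasurable_comp_sub hf).integral_prod_right'

theorem lintegral_lintegral_enorm_sq_comp_sub (hf : AEStronglyMeasurable f volume) :
    ∫⁻ x, ∫⁻ y, ‖f (x - y)‖ₑ ^ 2 ∂ν = ∫⁻ x, ‖f x‖ₑ ^ 2 := by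
  rw [lintegral_lintegral_swap ((aestronglyMeasurable_comp_sub hf).enorm.pow_const 2)]
  simp_rw [fun y => lintegral_sub_right_eq_self (μ := volume) (fun x => ‖f x‖ₑ ^ 2) y]
  simp

theorem lintegral_enorm_sq_eq_eLpNorm_sq (f : ℝ → ℂ) (ρ : Measure ℝ) :
    ∫⁻ x, ‖f x‖ₑ ^ 2 ∂ρ = eLpNorm f 2 ρ ^ 2 := by
  have := eLpNorm_nnreal_pow_eq_lintegral (f := f) (μ := ρ) (p := 2) two_ne_zero
  simpa using this.symm

theorem ae_memLp_comp_sub (hf : MemLp f 2 volume) :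
    ∀ᵐ x, MemLp (fun y => f (x - y)) 2 ν := by
  have hm : AEMeasurable (fun x => ∫⁻ y, ‖f (x - y)‖ₑ ^ 2 ∂ν) volume :=
    ((aestronglyMeasurable_comp_sub hf.1).enorm.pow_const 2).lintegral_prod_right'
  have hfin : ∫⁻ x, ∫⁻ y, ‖f (x - y)‖ₑ ^ 2 ∂ν ≠ ∞ := by
    rw [lintegral_lintegral_enorm_sq_comp_sub hf.1, lintegral_enorm_sq_eq_eLpNorm_sq]
    exact ENNReal.pow_ne_top hf.2.ne
  filter_upwards [ae_lt_top' hm hfin,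
    (aestronglyMeasurable_comp_sub (ν := ν) hf.1).prodMk_left] with x hx hx'
  refine ⟨hx', ?_⟩
  rw [lintegral_enorm_sq_eq_eLpNorm_sq (fun y => f (x - y))] at hx
  exact (ENNReal.pow_lt_top_iff).1 hx |>.resolve_right two_ne_zero

theorem ae_integrable_comp_sub (hf : MemLp f 2 volume) :
    ∀ᵐ x, Integrable (fun y => f (x - y)) ν := by
  filter_upwards [ae_memLp_comp_sub (ν := ν) hf] with x hx
  exact hx.integrable one_le_two

/-- Convolution with a probability measure is a contraction of `L²`. -/
theorem eLpNorm_convMeasure_le (hf : MemLp f 2 volume) :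
    eLpNorm (convMeasure ν f) 2 volume ≤ eLpNorm f 2 volume := by
  rw [← ENNReal.pow_le_pow_left_iff two_ne_zero, ← lintegral_enorm_sq_eq_eLpNorm_sq,
    ← lintegral_enorm_sq_eq_eLpNorm_sq, ← lintegral_lintegral_enorm_sq_comp_sub (ν := ν) hf.1]
  refine lintegral_mono_ae ?_
  filter_upwards [ae_memLp_comp_sub (ν := ν) hf] with x hx
  rw [lintegral_enorm_sq_eq_eLpNorm_sq (fun y => f (x - y))]
  gcongr
  refine le_trans (enorm_integral_le_lintegral_enorm _) ?_
  rw [← eLpNorm_one_eq_lintegral_enorm]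
  exact eLpNorm_le_eLpNorm_of_exponent_le one_le_two hx.1

theorem memLp_convMeasure (hf : MemLp f 2 volume) : MemLp (convMeasure ν f) 2 volume :=
  ⟨aestronglyMeasurable_convMeasure hf.1, (eLpNorm_convMeasure_le hf).trans_lt hf.2⟩

theorem convMeasure_sub_ae (hf : MemLp f 2 volume) (hg : MemLp g 2 volume) :
    convMeasure ν (f - g) =ᵐ[volume] convMeasure ν f - convMeasure ν g := by
  filter_upwards [ae_integrable_comp_sub (ν := ν) hf, ae_integrable_comp_sub (ν := ν) hg]
    with x hx hx'
  exact integral_sub hx hx'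

theorem memLp_fourierMultiplier (ν : Measure ℝ) [IsProbabilityMeasure ν] :
    MemLp (fourierMultiplier ν) ∞ volume :=
  memLp_top_of_bound (continuous_fourierMultiplier ν).aestronglyMeasurable 1
    (Eventually.of_forall (norm_fourierMultiplier_le_one ν))

/-- The operator of `L²` that multiplies the Fourier transform by that of `ν`. -/
def multiplierOp (ν : Measure ℝ) [IsProbabilityMeasure ν] (F : Lp ℂ 2 (volume : Measure ℝ)) :
    Lp ℂ 2 (volume : Measure ℝ) :=
  𝓕⁻ ((memLp_fourierMultiplier ν).toLp • 𝓕 F : Lp ℂ 2 (volume : Measure ℝ))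

theorem norm_fourierInv_eq (F : Lp ℂ 2 (volume : Measure ℝ)) : ‖𝓕⁻ F‖ = ‖F‖ :=
  (Lp.fourierTransformₗᵢ ℝ ℂ).symm.norm_map F

theorem multiplierOp_sub (F G : Lp ℂ 2 (volume : Measure ℝ)) :
    multiplierOp ν (F - G) = multiplierOp ν F - multiplierOp ν G := by
  have h1 : 𝓕 (F - G) = 𝓕 F - 𝓕 G := (Lp.fourierTransformₗᵢ ℝ ℂ).map_sub F G
  unfold multiplierOp
  rw [h1, sub_eq_add_neg, Lp.add_smul, Lp.smul_neg, ← sub_eq_add_neg]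
  exact (Lp.fourierTransformₗᵢ ℝ ℂ).symm.map_sub _ _

theorem norm_multiplierOp_le (F : Lp ℂ 2 (volume : Measure ℝ)) : ‖multiplierOp ν F‖ ≤ ‖F‖ := by
  rw [multiplierOp, norm_fourierInv_eq, ← Lp.norm_fourier_eq F]
  refine (Lp.norm_smul_le _ _).trans (mul_le_of_le_one_left (norm_nonneg _) ?_)
  rw [Lp.norm_toLp, eLpNorm_exponent_top]
  refine ENNReal.toReal_le_of_le_ofReal zero_le_one ?_
  exact eLpNormEssSup_le_of_ae_bound (Eventually.of_forall (norm_fourierMultiplier_le_one ν))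

/-- Fubini's theorem applied to the Fourier inversion formula for a Schwartz function. -/
theorem convMeasure_schwartz (φ : 𝓢(ℝ, ℂ)) (x : ℝ) :
    convMeasure ν φ x = 𝓕⁻ (fun ξ => fourierMultiplier ν ξ * 𝓕 φ ξ) x := by
  have hinv : ∀ z : ℝ, φ z =
      ∫ ξ, Complex.exp ((2 * Real.pi * (ξ * z) : ℝ) * Complex.I) * 𝓕 φ ξ := by
    intro z
    have h : φ z = 𝓕⁻ (𝓕 φ) z := by rw [fourierInv_fourier_eq]
    rw [h, fourierInv_coe, Real.fourierInv_eq']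
    simp [mul_comm z]
  have hint : Integrable (fun p : ℝ × ℝ =>
      Complex.exp ((2 * Real.pi * (p.2 * (x - p.1)) : ℝ) * Complex.I) * 𝓕 φ p.2)
      (ν.prod volume) := by
    refine (((𝓕 φ).integrable (μ := volume)).comp_snd ν).mono
      (Continuous.aestronglyMeasurable ?_) (Eventually.of_forall fun p => ?_)
    · have := (𝓕 φ).continuous
      fun_prop
    · rw [norm_mul, Complex.norm_exp_ofReal_mul_I, one_mul]
  unfold convMeasure
  simp_rw [hinv]
  rw [integral_integral_swap hint, Real.fourierInv_eq']
  refine integral_congr_ae (Eventually.of_forall fun ξ => ?_)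
  simp only
  rw [integral_mul_const, smul_eq_mul, ← mul_assoc, fourierMultiplier, charFun_apply_real,
    ← integral_const_mul]
  congr 2
  ext y
  rw [← Complex.exp_add]
  congr 1
  simp only [RCLike.inner_apply, conj_trivial]
  push_cast
  ring

theorem convMeasure_schwartz_ae (φ : 𝓢(ℝ, ℂ)) :
    convMeasure ν φ =ᵐ[volume] multiplierOp ν (φ.toLp 2) := by
  have hm := continuous_fourierMultiplier ν
  have h1 : Integrable (fun ξ => fourierMultiplier ν ξ * 𝓕 φ ξ) :=
    ((𝓕 φ).integrable).bdd_mul hm.aestronglyMeasurable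
      (Eventually.of_forall (norm_fourierMultiplier_le_one ν))
  have h2 : MemLp (fun ξ => fourierMultiplier ν ξ * 𝓕 φ ξ) 2 volume :=
    ((𝓕 φ).memLp 2).mul (memLp_fourierMultiplier ν)
  have h3 : multiplierOp ν (φ.toLp 2) = 𝓕⁻ (h2.toLp _) := by
    unfold multiplierOp
    congr 1
    rw [SchwartzMap.toLp_fourier_eq]
    refine Lp.ext ?_
    filter_upwards [Lp.coeFn_lpSMul (r := 2) (memLp_fourierMultiplier ν).toLp ((𝓕 φ).toLp 2),
      h2.coeFn_toLp, (memLp_fourierMultiplier ν).coeFn_toLp, (𝓕 φ).coeFn_toLp 2 volume]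
      with x e1 e2 e3 e4
    rw [e1, e2, Pi.smul_apply', e3, e4, smul_eq_mul]
  rw [h3]
  refine EventuallyEq.trans (Eventually.of_forall (convMeasure_schwartz φ)) ?_
  exact (coeFn_fourierInv_toLp h1 h2).symm

/-- The identification of convolution with a Fourier multiplier passes from Schwartz functions to
`L²` because both sides are contractions. -/
theorem convMeasure_ae_eq_multiplierOp (hf : MemLp f 2 volume) :
    convMeasure ν f =ᵐ[volume] multiplierOp ν (hf.toLp f) := by
  have hconv := memLp_convMeasure (ν := ν) hf
  suffices h : hconv.toLp _ = multiplierOp ν (hf.toLp f) from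
    hconv.coeFn_toLp.symm.trans (h ▸ EventuallyEq.rfl)
  refine eq_of_forall_dist_le fun ε hε => ?_
  obtain ⟨φ, hφ⟩ := (SchwartzMap.denseRange_toLpCLM (F := ℂ) (E := ℝ)
    (ENNReal.ofNat_ne_top (n := 2)) (μ := (volume : Measure ℝ))).exists_dist_lt
    (hf.toLp f) (half_pos hε)
  have hφ : ‖hf.toLp f - φ.toLp 2 volume‖ < ε / 2 := by rwa [← dist_eq_norm]
  have hφm : MemLp (⇑φ) 2 volume := φ.memLp 2 volume
  have hd : MemLp (f - ⇑φ) 2 volume := hf.sub hφm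
  have hdconv := memLp_convMeasure (ν := ν) hd
  have hle : ‖hdconv.toLp _‖ ≤ ‖hd.toLp _‖ := by
    rw [Lp.norm_toLp, Lp.norm_toLp]
    exact ENNReal.toReal_mono hd.2.ne (eLpNorm_convMeasure_le hd)
  have hsub : hconv.toLp _ - multiplierOp ν (φ.toLp 2 volume) = hdconv.toLp _ := by
    refine Lp.ext ?_
    filter_upwards [Lp.coeFn_sub (hconv.toLp _) (multiplierOp ν (φ.toLp 2 volume)),
      hconv.coeFn_toLp, hdconv.coeFn_toLp, convMeasure_schwartz_ae (ν := ν) φ,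
      convMeasure_sub_ae (ν := ν) hf hφm]
      with x e1 e2 e3 e4 e5
    rw [e1, e3, e5, Pi.sub_apply, e2, Pi.sub_apply, e4]
  have hdeq : hd.toLp _ = hf.toLp f - φ.toLp 2 volume := MemLp.toLp_sub hf hφm
  rw [dist_eq_norm]
  calc _ = ‖hdconv.toLp _ - multiplierOp ν (hf.toLp f - φ.toLp 2 volume)‖ := by
        rw [← hsub, multiplierOp_sub]; congr 1; abel
    _ ≤ ‖hf.toLp f - φ.toLp 2 volume‖ + ‖hf.toLp f - φ.toLp 2 volume‖ := by
        refine (norm_sub_le _ _).trans (add_le_add ?_ (norm_multiplierOp_le _))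
        rwa [← hdeq]
    _ ≤ ε := by linarith

/-- Plancherel's theorem for the difference of two convolutions. -/
theorem lintegral_enorm_convMeasure_sub_sq {ν' : Measure ℝ} [IsProbabilityMeasure ν']
    (hf : MemLp f 2 volume) :
    ∫⁻ x, ‖convMeasure ν f x - convMeasure ν' f x‖ₑ ^ 2 =
      ∫⁻ ξ, ‖fourierMultiplier ν ξ - fourierMultiplier ν' ξ‖ₑ ^ 2 *
        ‖(𝓕 (hf.toLp f) : Lp ℂ 2 (volume : Measure ℝ)) ξ‖ₑ ^ 2 := by
  set F := hf.toLp f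
  set G : Lp ℂ 2 (volume : Measure ℝ) := (memLp_fourierMultiplier ν).toLp • 𝓕 F
  set G' : Lp ℂ 2 (volume : Measure ℝ) := (memLp_fourierMultiplier ν').toLp • 𝓕 F
  have h1 : multiplierOp ν F - multiplierOp ν' F = 𝓕⁻ (G - G') :=
    ((Lp.fourierTransformₗᵢ ℝ ℂ).symm.map_sub G G').symm
  have h2 : eLpNorm (multiplierOp ν F - multiplierOp ν' F : Lp ℂ 2 (volume : Measure ℝ)) 2 volume =
      eLpNorm (G - G' : Lp ℂ 2 (volume : Measure ℝ)) 2 volume := by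
    rw [← ENNReal.toReal_eq_toReal_iff' (Lp.eLpNorm_ne_top _) (Lp.eLpNorm_ne_top _),
      ← Lp.norm_def, ← Lp.norm_def, h1, norm_fourierInv_eq]
  have h3 : ∫⁻ x, ‖convMeasure ν f x - convMeasure ν' f x‖ₑ ^ 2 =
      ∫⁻ x, ‖(multiplierOp ν F - multiplierOp ν' F : Lp ℂ 2 (volume : Measure ℝ)) x‖ₑ ^ 2 := by
    refine lintegral_congr_ae ?_
    filter_upwards [Lp.coeFn_sub (multiplierOp ν F) (multiplierOp ν' F),
      convMeasure_ae_eq_multiplierOp (ν := ν) hf, convMeasure_ae_eq_multiplierOp (ν := ν') hf]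
      with x e1 e2 e3
    rw [e1, Pi.sub_apply, e2, e3]
  rw [h3, lintegral_enorm_sq_eq_eLpNorm_sq, h2, ← lintegral_enorm_sq_eq_eLpNorm_sq]
  refine lintegral_congr_ae ?_
  filter_upwards [Lp.coeFn_sub G G',
    Lp.coeFn_lpSMul (r := 2) (memLp_fourierMultiplier ν).toLp (𝓕 F),
    Lp.coeFn_lpSMul (r := 2) (memLp_fourierMultiplier ν').toLp (𝓕 F),
    (memLp_fourierMultiplier ν).coeFn_toLp, (memLp_fourierMultiplier ν').coeFn_toLp]
    with x e1 e2 e3 e4 e5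
  rw [e1, Pi.sub_apply, e2, e3, Pi.smul_apply', Pi.smul_apply', e4, e5, ← sub_smul, enorm_smul,
    mul_pow]

end Convolution

/-! ### The `L²` bound for the square function -/

instance isProbabilityMeasure_contraction (t : ℝ) (ν : Measure ℝ) [IsProbabilityMeasure ν] :
    IsProbabilityMeasure (contraction t ν) :=
  Measure.isProbabilityMeasure_map (by fun_prop)

theorem aemeasurable_enorm_convMeasure_sub_sq {ν ν' : Measure ℝ} [IsProbabilityMeasure ν]
    [IsProbabilityMeasure ν'] {f : ℝ → ℂ} (hf : AEStronglyMeasurable f volume) :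
    AEMeasurable (fun x => ‖convMeasure ν f x - convMeasure ν' f x‖ₑ ^ 2) volume :=
  ((aestronglyMeasurable_convMeasure hf).sub
    (aestronglyMeasurable_convMeasure hf)).enorm.pow_const 2

theorem aemeasurable_squareFunction {μ : Measure ℝ} [IsProbabilityMeasure μ] {t : ℕ → ℝ}
    {f : ℝ → ℂ} (hf : AEStronglyMeasurable f volume) :
    AEMeasurable (squareFunction μ t f) volume :=
  (AEMeasurable.tsum fun _ => aemeasurable_enorm_convMeasure_sub_sq hf).pow_const _

/-- A uniform bound for the sum of the squared multipliers gives the `L²` bound for the square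
function. -/
theorem eLpNorm_squareFunction_le {μ : Measure ℝ} [IsProbabilityMeasure μ] {t : ℕ → ℝ}
    {B : ℝ≥0∞} (hB : ∀ ξ, ∑' k, ‖fourierMultiplier unitLebesgue (t k * ξ) -
      fourierMultiplier μ (t k * ξ)‖ₑ ^ 2 ≤ B) {f : ℝ → ℂ} (hf : MemLp f 2 volume) :
    eLpNorm (squareFunction μ t f) 2 volume ≤ B ^ (1 / 2 : ℝ) * eLpNorm f 2 volume := by
  have hS : ∀ x, squareFunction μ t f x ^ (2 : ℝ) =
      ∑' k, ‖convMeasure (contraction (t k) unitLebesgue) f x -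
        convMeasure (contraction (t k) μ) f x‖ₑ ^ 2 := by
    intro x
    rw [squareFunction, ← ENNReal.rpow_mul]
    norm_num
  have hF : ∫⁻ ξ, ‖(𝓕 (hf.toLp f) : Lp ℂ 2 (volume : Measure ℝ)) ξ‖ₑ ^ 2 =
      eLpNorm f 2 volume ^ 2 := by
    rw [lintegral_enorm_sq_eq_eLpNorm_sq]
    congr 1
    rw [← ENNReal.toReal_eq_toReal_iff' (Lp.eLpNorm_ne_top _) hf.2.ne, ← Lp.norm_def,
      Lp.norm_fourier_eq, Lp.norm_toLp]
  have hmain : ∫⁻ x, squareFunction μ t f x ^ (2 : ℝ) ≤ B * eLpNorm f 2 volume ^ 2 := by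
    simp_rw [hS]
    rw [lintegral_tsum fun k => aemeasurable_enorm_convMeasure_sub_sq hf.1]
    simp_rw [lintegral_enorm_convMeasure_sub_sq hf, fourierMultiplier_contraction]
    rw [← lintegral_tsum]
    · simp_rw [ENNReal.tsum_mul_right]
      rw [← hF, ← lintegral_const_mul'' _ ((Lp.aestronglyMeasurable _).enorm.pow_const 2)]
      exact lintegral_mono fun ξ => by gcongr; exact hB ξ
    · intro k
      have h1 := continuous_fourierMultiplier unitLebesgue
      have h2 := continuous_fourierMultiplier μ
      have h3 : Continuous fun ξ => fourierMultiplier unitLebesgue (t k * ξ) -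
        fourierMultiplier μ (t k * ξ) := by fun_prop
      exact (h3.aestronglyMeasurable.enorm.pow_const 2).mul
        ((Lp.aestronglyMeasurable _).enorm.pow_const 2)
  rw [eLpNorm_eq_lintegral_rpow_enorm_toReal two_ne_zero ENNReal.ofNat_ne_top]
  simp only [ENNReal.toReal_ofNat, enorm_eq_self]
  calc _ ≤ (B * eLpNorm f 2 volume ^ 2) ^ (1 / 2 : ℝ) := by gcongr
    _ = _ := by
      rw [ENNReal.mul_rpow_of_nonneg _ _ (by norm_num), ← ENNReal.rpow_natCast,
        ← ENNReal.rpow_mul (eLpNorm f 2 volume)]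
      norm_num

end RieszSquareFunction

end

open RieszSquareFunction in
/-- There is a Riesz product measure, with all coefficients equal to `1` and frequencies of ratio
at least `4`, and a decreasing positive null sequence `t`, for which the square function satisfies
a strong `L²` bound on `ℝ`. The convolutions occurring in it converge absolutely almost
everywhere, and the square function is measurable. -/
theorem mainTheorem2 :
    ∃ (n : ℕ → ℕ) (μ : ProbabilityMeasure ℝ) (t : ℕ → ℝ),
      IsRieszProductMeasure (fun _ => 1) n μ ∧
      (∀ m, 4 * n m ≤ n (m + 1)) ∧
      (∀ k, 0 < t k) ∧ StrictAnti t ∧ Tendsto t atTop (𝓝 0) ∧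
      ∃ C : ℝ≥0, ∀ f : ℝ → ℂ, MemLp f 2 volume →
        (∀ᵐ x, ∀ k,
          Integrable (fun y => f (x - y)) (contraction (t k) unitLebesgue) ∧
          Integrable (fun y => f (x - y)) (contraction (t k) (μ : Measure ℝ))) ∧
        AEMeasurable (squareFunction (μ : Measure ℝ) t f) volume ∧
        eLpNorm (squareFunction (μ : Measure ℝ) t f) 2 volume ≤ C * eLpNorm f 2 volume := by
  obtain ⟨μ, hμ⟩ := exists_isRieszProductMeasure_freq
  have hC : (4 + 4096 * scaleBound) ^ (1 / 2 : ℝ) ≠ ∞ :=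
    ENNReal.rpow_ne_top_of_nonneg (by norm_num)
      (ENNReal.add_ne_top.2 ⟨by simp, ENNReal.mul_ne_top (by simp) scaleBound_ne_top⟩)
  refine ⟨freq, μ, scale, hμ,
    fun m => (Nat.mul_le_mul_right _ (by norm_num)).trans (eight_mul_freq_le m), scale_pos,
    strictAnti_scale, tendsto_scale, ((4 + 4096 * scaleBound) ^ (1 / 2 : ℝ)).toNNReal,
    fun f hf => ⟨?_, aemeasurable_squareFunction hf.1, ?_⟩⟩
  · exact ae_all_iff.2 fun k => (ae_integrable_comp_sub hf).and (ae_integrable_comp_sub hf)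
  · rw [ENNReal.coe_toNNReal hC]
    exact eLpNorm_squareFunction_le (tsum_enorm_fourierMultiplier_sub_sq_le hμ) hf
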